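/- Let $G$ be a simple graph with totally ordered vertex set $I$, and let $\Psi\subseteq I$ be a set of vertices, called odd. Write $\alpha\,\zeta\,\beta$ if $\alpha=\beta$ or $\alpha,\beta$ are adjacent in $G$. A \emph{heap} is a finite set $E\subset I\times\{0,1,2,\dots\}$ of pieces $(\alpha,m)$ (position $\alpha$, level $m$) such that distinct pieces with $\zeta$-related positions have different levels, and for every $(\alpha,m)\in E$ with $m>0$ there is $(\beta,m-1)\in E$ with $\alpha\,\zeta\,\beta$. Heaps form a monoid $\mathcal H(I,\zeta)$ under superposition $E\circ F$ (the pieces of $F$, lower ones first, fall over $E$), whose unit is the empty heap. The \emph{standard word} $\operatorname{st}(E)$ is the lexicographically greatest word $p_1\cdots p_k\in I^*$ with $p_1\circ\cdots\circ p_k=E$, and $\mathcal H(I,\zeta)$ is totally ordered by $E\le F \iff \operatorname{st}(E)\le\operatorname{st}(F)$ lexicographically. A heap is \emph{odd} if it has an odd number of pieces with positions in $\Psi$. The order $\le_E$ on the pieces of $E$ is the reflexive and transitive closure of the relation that relates $(\alpha,m)$ to $(\beta,n)$ when $\alpha\,\zeta\,\beta$ and $m<n$. A heap $E$ is a \emph{Lyndon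 heap} if it is non-empty, primitive ($E=U\circ V=V\circ U$ implies that $U$ or $V$ is empty) and minimal in its conjugacy class, conjugacy being the transitive closure of the relation between $U\circ V$ and $V\circ U$. It is a \emph{super Lyndon heap} if it is a Lyndon heap, or $E=F\circ F$ for some odd Lyndon heap $F$. Let $i\in I$. A \emph{super-letter with basis $i$} is a heap $E$ that has exactly one $\le_E$-minimal piece, this piece being at position $i$, that has exactly one piece at position $i$, and all of whose positions are $\ge i$. Let $\mathcal A_i(I,\zeta)\subset\mathcal H(I,\zeta)$ be the set of these, with the induced total order, and let $\mathcal A_i^*(I,\zeta)$ be the submonoid of $\mathcal H(I,\zeta)$ that it generates. A non-empty word over $\mathcal A_i(I,\zeta)$ is a \emph{Lyndon word} if it is lexicographically strictly smaller than all its proper cyclic rotations; a word is a \emph{super Lyndon word} if it is a Lyndon word, or is of the form $uu$ with $u$ a Lyndon word whose product is an odd heap. Then every $E\in\mathcal A_i^*(I,\zeta)$ is the product of a unique word over $\mathcal A_i(I,\zeta)$ (that is, $\mathcal A_i^*(I,\zeta)$ is free on $\mathcal A_i(I,\zeta)$), and this word is a super Lyndon word if and only if $E$ is a super Lyndon heap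 in $\mathcal H(I,\zeta)$. -/

import Mathlib

noncomputable section

open scoped Classical

namespace HeapsOfPieces

set_option linter.unusedSectionVars false

variable {I : Type*} [LinearOrder I]

/-- The concurrency relation `ζ` of a graph: two positions are concurrent when they do not commute,
that is, when they are equal or adjacent. -/
def Conc (G : SimpleGraph I) (a b : I) : Prop := a = b ∨ G.Adj a b

lemma Conc.symm {G : SimpleGraph I} {a b : I} (h : Conc G a b) : Conc G b a :=
  h.elim (fun h => Or.inl h.symm) (fun h => Or.inr h.symm)

/-- A heap over `(I, ζ)`: a finite set of pieces `(position, level)` in which two distinct concurrent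
pieces are at different levels (pre-heap) and in which every piece above the floor lies on a
concurrent piece one level below. -/
@[ext]
structure Heap (G : SimpleGraph I) where
  pieces : Finset (I × ℕ)
  level_ne : ∀ p ∈ pieces, ∀ q ∈ pieces, p ≠ q → Conc G p.1 q.1 → p.2 ≠ q.2
  supported : ∀ p ∈ pieces, 0 < p.2 → ∃ q ∈ pieces, q.2 + 1 = p.2 ∧ Conc G p.1 q.1

namespace Heap

variable {G : SimpleGraph I}

/-- The level at which a piece dropped at position `a` over `E` comes to rest. -/
def restLevel (E : Heap G) (a : I) : ℕ :=
  (E.pieces.filter fun p => Conc G p.1 a).sup fun p => p.2 + 1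

lemma lt_restLevel {E : Heap G} {a : I} {p : I × ℕ} (hp : p ∈ E.pieces) (h : Conc G p.1 a) :
    p.2 < E.restLevel a :=
  Nat.lt_of_succ_le (Finset.le_sup (f := fun p : I × ℕ => p.2 + 1) (by simp [hp, h]))

lemma exists_restLevel {E : Heap G} {a : I} (h : 0 < E.restLevel a) :
    ∃ q ∈ E.pieces, q.2 + 1 = E.restLevel a ∧ Conc G q.1 a := by
  have hne : (E.pieces.filter fun p => Conc G p.1 a).Nonempty := by
    rw [Finset.nonempty_iff_ne_empty]
    intro h0
    simp [restLevel, h0] at h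
  obtain ⟨q, hq, hq'⟩ := Finset.exists_mem_eq_sup _ hne (fun p : I × ℕ => p.2 + 1)
  simp only [Finset.mem_filter] at hq
  exact ⟨q, hq.1, hq'.symm, hq.2⟩

lemma restLevel_eq {E : Heap G} {a : I} {n : ℕ}
    (h1 : ∀ q ∈ E.pieces, Conc G q.1 a → q.2 < n)
    (h2 : 0 < n → ∃ q ∈ E.pieces, q.2 + 1 = n ∧ Conc G q.1 a) : E.restLevel a = n := by
  apply le_antisymm
  · refine Finset.sup_le fun q hq => ?_
    simp only [Finset.mem_filter] at hq
    exact h1 q hq.1 hq.2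
  · rcases Nat.eq_zero_or_pos n with h | h
    · omega
    · obtain ⟨q, hq, hq', hc⟩ := h2 h
      have := lt_restLevel hq hc
      omega

/-- Drop one piece at position `a` over the heap `E`. -/
def push (E : Heap G) (a : I) : Heap G where
  pieces := insert (a, E.restLevel a) E.pieces
  level_ne := by
    intro p hp q hq hpq hc
    simp only [Finset.mem_insert] at hp hq
    rcases hp with rfl | hp <;> rcases hq with rfl | hq
    · exact absurd rfl hpq
    · exact (lt_restLevel hq hc.symm).ne'
    · exact (lt_restLevel hp hc).ne
    · exact E.level_ne p hp q hq hpq hc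
  supported := by
    intro p hp h0
    simp only [Finset.mem_insert] at hp
    rcases hp with rfl | hp
    · obtain ⟨q, hq, h1, h2⟩ := exists_restLevel h0
      exact ⟨q, by simp [hq], h1, h2.symm⟩
    · obtain ⟨q, hq, h1⟩ := E.supported p hp h0
      exact ⟨q, by simp [hq], h1⟩

/-- Drop pieces at the positions `w = a₁ a₂ ⋯ aₖ` over `E`, one after another. -/
def drop (E : Heap G) (w : List I) : Heap G := w.foldl push E

/-- The pieces of a heap as pairs (level, position), listed from the floor upwards. -/
def sortedPieces (E : Heap G) : List (ℕ ×ₗ I) :=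
  (E.pieces.image fun p => toLex (p.2, p.1)).sort

/-- The positions of the pieces of a heap, listed from the floor upwards. -/
def positions (E : Heap G) : List I := E.sortedPieces.map fun p => (ofLex p).2

/-- The empty heap. -/
instance : One (Heap G) := ⟨⟨∅, by simp, by simp⟩⟩

/-- The superposition `E ∘ F`: the pieces of `F` fall over `E`, the lower ones first. -/
instance : Mul (Heap G) := ⟨fun E F => E.drop F.positions⟩

lemma one_pieces : (1 : Heap G).pieces = ∅ := rfl

lemma mul_def (E F : Heap G) : E * F = E.drop F.positions := rfl

lemma not_mem_push (E : Heap G) (a : I) : (a, E.restLevel a) ∉ E.pieces := fun h =>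
  lt_irrefl _ (lt_restLevel (E := E) (a := a) h (Or.inl rfl))

lemma restLevel_push {E : Heap G} {a b : I} (h : ¬ Conc G a b) :
    (E.push a).restLevel b = E.restLevel b := by
  simp only [restLevel, push, Finset.filter_insert, h, if_false]

lemma push_comm (E : Heap G) {a b : I} (h : ¬ Conc G a b) :
    (E.push a).push b = (E.push b).push a := by
  have h' : ¬ Conc G b a := fun hc => h hc.symm
  ext1
  change insert (b, (E.push a).restLevel b) (insert (a, E.restLevel a) E.pieces) =
    insert (a, (E.push b).restLevel a) (insert (b, E.restLevel b) E.pieces)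
  rw [restLevel_push h, restLevel_push h', Finset.insert_comm]

lemma drop_push (E : Heap G) (a : I) (w : List I) (h : ∀ b ∈ w, ¬ Conc G b a) :
    (E.push a).drop w = (E.drop w).push a := by
  induction w generalizing E with
  | nil => rfl
  | cons b w ih =>
    change ((E.push a).push b).drop w = ((E.push b).drop w).push a
    rw [← push_comm E (h b (by simp)), ih _ (fun c hc => h c (by simp [hc]))]

lemma mem_sortedPieces {E : Heap G} {p : ℕ ×ₗ I} :
    p ∈ E.sortedPieces ↔ ((ofLex p).2, (ofLex p).1) ∈ E.pieces := by
  simp only [sortedPieces, Finset.mem_sort, Finset.mem_image, Prod.exists]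
  constructor
  · rintro ⟨a, n, h, rfl⟩
    exact h
  · intro h
    exact ⟨_, _, h, rfl⟩

lemma mul_push (E F : Heap G) (a : I) : E * F.push a = (E * F).push a := by
  have hmem : toLex (F.restLevel a, a) ∈ (F.push a).sortedPieces := by
    rw [mem_sortedPieces]
    simp [push]
  obtain ⟨s, t, hst⟩ := List.append_of_mem hmem
  have hsorted : (F.push a).sortedPieces.Pairwise (· ≤ ·) := Finset.pairwise_sort _ _
  have hnodup : (F.push a).sortedPieces.Nodup := Finset.sort_nodup _ _
  rw [hst] at hsorted hnodup
  have hF : F.sortedPieces = s ++ t := by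
    have hsub : (s ++ t).Sublist (s ++ toLex (F.restLevel a, a) :: t) := by simp
    refine List.Perm.eq_of_pairwise' (r := (· ≤ ·)) (Finset.pairwise_sort _ _)
      (hsorted.sublist hsub) ?_
    refine (List.perm_ext_iff_of_nodup (Finset.sort_nodup _ _) (hnodup.sublist hsub)).2 ?_
    intro p
    have h1 : p ∈ (F.push a).sortedPieces ↔ p = toLex (F.restLevel a, a) ∨ p ∈ s ++ t := by
      rw [hst]
      simp only [List.mem_append, List.mem_cons]
      tauto
    have h2 : p ∈ (F.push a).sortedPieces ↔
        p = toLex (F.restLevel a, a) ∨ p ∈ F.sortedPieces := by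
      rw [mem_sortedPieces, mem_sortedPieces]
      simp only [push, Finset.mem_insert]
      refine or_congr ⟨fun h => ?_, fun h => by rw [h]; rfl⟩ Iff.rfl
      rw [Prod.ext_iff] at h
      exact ofLex.injective (Prod.ext h.2 h.1)
    have h3 : toLex (F.restLevel a, a) ∉ F.sortedPieces := by
      rw [mem_sortedPieces]
      exact not_mem_push F a
    have h4 : toLex (F.restLevel a, a) ∉ s ++ t := by
      rw [List.nodup_middle, List.nodup_cons] at hnodup
      exact hnodup.1
    change p ∈ F.sortedPieces ↔ _
    by_cases hp : p = toLex (F.restLevel a, a)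
    · subst hp
      exact iff_of_false h3 h4
    · have := h1.symm.trans h2
      simpa [hp] using this.symm
  have ht : ∀ b ∈ t.map (fun p => (ofLex p).2), ¬ Conc G b a := by
    intro b hb hc
    obtain ⟨p, hp, rfl⟩ := List.mem_map.1 hb
    have hle : toLex (F.restLevel a, a) ≤ p := by
      rw [List.pairwise_append, List.pairwise_cons] at hsorted
      exact hsorted.2.1.1 p hp
    have hpF : p ∈ F.sortedPieces := by rw [hF]; simp [hp]
    rw [mem_sortedPieces] at hpF
    have := lt_restLevel hpF hc
    rw [Prod.Lex.le_iff] at hle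
    simp only [ofLex_toLex] at hle
    rcases hle with h | h
    · exact absurd this (not_lt.2 h.le)
    · exact absurd this (not_lt.2 h.1.le)
  have e1 : (F.push a).positions =
      s.map (fun p => (ofLex p).2) ++ a :: t.map (fun p => (ofLex p).2) := by
    simp [positions, hst]
  have e2 : F.positions = s.map (fun p => (ofLex p).2) ++ t.map (fun p => (ofLex p).2) := by
    simp [positions, hF]
  rw [mul_def, mul_def, e1, e2]
  simp only [drop, List.foldl_append, List.foldl_cons]
  exact drop_push _ a _ ht

lemma mul_drop (E F : Heap G) (w : List I) : E * F.drop w = (E * F).drop w := by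
  induction w generalizing F with
  | nil => rfl
  | cons a w ih =>
    change E * (F.push a).drop w = ((E * F).push a).drop w
    rw [ih, mul_push]

lemma exists_push {E : Heap G} (h : E.pieces.Nonempty) : ∃ (F : Heap G) (a : I), E = F.push a := by
  obtain ⟨p, hp, hmax⟩ := E.pieces.exists_max_image (fun p => p.2) h
  let F : Heap G :=
    { pieces := E.pieces.erase p
      level_ne := fun q hq r hr =>
        E.level_ne q (Finset.mem_of_mem_erase hq) r (Finset.mem_of_mem_erase hr)
      supported := by
        intro q hq h0
        obtain ⟨r, hr, h1, h2⟩ := E.supported q (Finset.mem_of_mem_erase hq) h0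
        refine ⟨r, Finset.mem_erase.2 ⟨?_, hr⟩, h1, h2⟩
        rintro rfl
        have := hmax q (Finset.mem_of_mem_erase hq)
        omega }
  have hlev : F.restLevel p.1 = p.2 := by
    apply restLevel_eq
    · intro q hq hc
      have hq' := Finset.mem_erase.1 hq
      exact lt_of_le_of_ne (hmax q hq'.2) (E.level_ne q hq'.2 p hp hq'.1 hc)
    · intro h0
      obtain ⟨r, hr, h1, h2⟩ := E.supported p hp h0
      refine ⟨r, Finset.mem_erase.2 ⟨?_, hr⟩, h1, h2.symm⟩
      rintro rfl
      omega
  refine ⟨F, p.1, ?_⟩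
  ext1
  change E.pieces = insert (p.1, F.restLevel p.1) (E.pieces.erase p)
  rw [hlev, Prod.mk.eta, Finset.insert_erase hp]

lemma push_card (E : Heap G) (a : I) : (E.push a).pieces.card = E.pieces.card + 1 :=
  Finset.card_insert_of_notMem (not_mem_push E a)

lemma exists_drop (E : Heap G) : ∃ w : List I, (1 : Heap G).drop w = E := by
  induction h : E.pieces.card generalizing E with
  | zero =>
    refine ⟨[], ?_⟩
    ext1
    exact (Finset.card_eq_zero.1 h).symm
  | succ n ih =>
    obtain ⟨F, a, rfl⟩ := exists_push (Finset.card_pos.1 (by omega : 0 < E.pieces.card))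
    rw [push_card] at h
    obtain ⟨w, hw⟩ := ih F (by omega)
    exact ⟨w ++ [a], by simp [drop, ← hw]⟩

lemma positions_one : (1 : Heap G).positions = [] := by
  simp [positions, sortedPieces, one_pieces]

/-- The heap monoid `H(I, ζ)`. -/
instance : Monoid (Heap G) where
  mul_assoc E F K := by rw [mul_def (E * F) K, ← mul_drop, ← mul_def]
  mul_one E := by rw [mul_def, positions_one]; rfl
  one_mul E := by
    obtain ⟨w, rfl⟩ := exists_drop E
    rw [mul_drop, mul_def, positions_one]
    rfl

/-- The heap with a single piece, at position `a`. -/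
def single (G : SimpleGraph I) (a : I) : Heap G where
  pieces := {(a, 0)}
  level_ne := by
    intro p hp q hq hpq
    simp only [Finset.mem_singleton] at hp hq
    exact absurd (hp.trans hq.symm) hpq
  supported := by
    intro p hp h0
    simp only [Finset.mem_singleton] at hp
    simp [hp] at h0

/-- The map `ψ : I^* → H(I, ζ)`, `p₁ ⋯ pₖ ↦ p₁ ∘ ⋯ ∘ pₖ`. -/
def ofWord (G : SimpleGraph I) (w : List I) : Heap G := (w.map (single G)).prod

lemma push_eq_mul (E : Heap G) (a : I) : E.push a = E * single G a := by
  simp [mul_def, positions, sortedPieces, single, drop]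

lemma drop_eq_mul (E : Heap G) (w : List I) : E.drop w = E * ofWord G w := by
  induction w generalizing E with
  | nil => simp [ofWord, drop]
  | cons a w ih =>
    change (E.push a).drop w = _
    rw [ih, push_eq_mul, mul_assoc]
    simp [ofWord]

lemma ofWord_surjective (E : Heap G) : ∃ w : List I, ofWord G w = E := by
  obtain ⟨w, hw⟩ := exists_drop E
  exact ⟨w, by rw [← hw, drop_eq_mul, one_mul]⟩

lemma drop_positions (E : Heap G) (w : List I) :
    (E.drop w).pieces.val.map Prod.fst = E.pieces.val.map Prod.fst + (w : Multiset I) := by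
  induction w generalizing E with
  | nil => simp [drop]
  | cons a w ih =>
    change ((E.push a).drop w).pieces.val.map Prod.fst = _
    rw [ih]
    change (insert (a, E.restLevel a) E.pieces).val.map Prod.fst + _ = _
    rw [Finset.insert_val_of_notMem (not_mem_push E a), Multiset.map_cons, ← Multiset.cons_coe,
      Multiset.cons_add, Multiset.add_cons]

lemma ofWord_finite (E : Heap G) : {w : List I | ofWord G w = E}.Finite := by
  obtain ⟨v, hv⟩ := ofWord_surjective E
  have key : ∀ w : List I, (ofWord G w).pieces.val.map Prod.fst = (w : Multiset I) := by
    intro w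
    rw [← one_mul (ofWord G w), ← drop_eq_mul, drop_positions, one_pieces]
    simp
  refine (List.finite_toSet v.permutations).subset fun w hw => ?_
  simp only [Set.mem_ofPred_eq, List.mem_permutations] at hw ⊢
  rw [← Multiset.coe_eq_coe, ← key, ← key, hw, hv]

lemma exists_standardWord (E : Heap G) : ∃ w, IsGreatest {w : List I | ofWord G w = E} w := by
  obtain ⟨w, hw, hmax⟩ :=
    Set.exists_max_image {w : List I | ofWord G w = E} id (ofWord_finite E) (ofWord_surjective E)
  exact ⟨w, hw, fun v hv => hmax v hv⟩

/-- The standard word `st(E)`: the lexicographically greatest word representing `E`. -/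
def standardWord (E : Heap G) : List I := (exists_standardWord E).choose

lemma standardWord_spec (E : Heap G) :
    IsGreatest {w : List I | ofWord G w = E} E.standardWord := (exists_standardWord E).choose_spec

lemma standardWord_injective : Function.Injective (standardWord (G := G)) := fun E F h => by
  rw [← (standardWord_spec E).1, ← (standardWord_spec F).1, h]

/-- The total order on heaps: `E ≤ F` iff `st(E) ≤ st(F)` lexicographically. -/
instance : LinearOrder (Heap G) := LinearOrder.lift' standardWord standardWord_injective

/-- The partial order `≤_E` on the pieces of `E`. -/
def PieceLE (E : Heap G) : I × ℕ → I × ℕ → Prop :=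
  Relation.ReflTransGen fun p q => p ∈ E.pieces ∧ q ∈ E.pieces ∧ Conc G p.1 q.1 ∧ p.2 < q.2

/-- The set `min E` of minimal pieces of `E` for `≤_E`. -/
def minPieces (E : Heap G) : Set (I × ℕ) :=
  {p | p ∈ E.pieces ∧ ∀ q ∈ E.pieces, E.PieceLE q p → q = p}

/-- `E` is a pyramid with basis `a`: it has a unique minimal piece, at position `a`. -/
def IsPyramid (E : Heap G) (a : I) : Prop := ∃ n, E.minPieces = {(a, n)}

/-- A pyramid with basis `a` is admissible if `a` is its lowest position. -/
def IsAdmissiblePyramid (E : Heap G) (a : I) : Prop :=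
  E.IsPyramid a ∧ ∀ p ∈ E.pieces, a ≤ p.1

/-- A pyramid with basis `a` is elementary if it has exactly one piece at position `a`. -/
def IsElementaryPyramid (E : Heap G) (a : I) : Prop :=
  E.IsPyramid a ∧ (E.pieces.filter fun p => p.1 = a).card = 1

/-- `E` is odd: it has an odd number of pieces whose positions are odd vertices. -/
def IsOdd (Ψ : Set I) (E : Heap G) : Prop := Odd (E.pieces.filter fun p => p.1 ∈ Ψ).card

/-- `E` is primitive: `E = U ∘ V = V ∘ U` only if `U` or `V` is empty. -/
def IsPrimitive (E : Heap G) : Prop := ∀ U V : Heap G, E = U * V → E = V * U → U = 1 ∨ V = 1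

/-- `F` is a transpose of `E`. -/
def IsTranspose (E F : Heap G) : Prop := ∃ U V : Heap G, E = U * V ∧ F = V * U

/-- Conjugacy of heaps: the transitive closure of transposition. -/
def IsConjugate : Heap G → Heap G → Prop := Relation.TransGen IsTranspose

/-- Lyndon heaps: non-empty, primitive, and minimal in their conjugacy class. -/
def IsLyndon (E : Heap G) : Prop := E ≠ 1 ∧ E.IsPrimitive ∧ ∀ F, IsConjugate E F → E ≤ F

/-- Super Lyndon heaps over the supergraph `(G, Ψ)`. -/
def IsSuperLyndon (Ψ : Set I) (E : Heap G) : Prop :=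
  E.IsLyndon ∨ ∃ F : Heap G, F.IsOdd Ψ ∧ F.IsLyndon ∧ E = F * F

end Heap

/-- The set `A_i(I, ζ)` of super-letters with basis `i`, ordered as a subset of `H(I, ζ)`. -/
def superLetters (G : SimpleGraph I) (i : I) : Set (Heap G) :=
  {E | E.IsAdmissiblePyramid i ∧ E.IsElementaryPyramid i}

/-- The submonoid `A_i^*(I, ζ)` of `H(I, ζ)` generated by the super-letters with basis `i`. -/
def superLetterMonoid (G : SimpleGraph I) (i : I) : Submonoid (Heap G) :=
  Submonoid.closure (superLetters G i)

/-- The heap spelled by a word in the super-letters with basis `i`. -/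
def spelledHeap {G : SimpleGraph I} {i : I} (w : List (superLetters G i)) : Heap G :=
  (w.map Subtype.val).prod

/-- Lyndon words over a totally ordered alphabet: non-empty words that are lexicographically strictly
smaller than all their proper cyclic rotations. -/
def IsLyndonWord {A : Type*} [LinearOrder A] (w : List A) : Prop :=
  w ≠ [] ∧ ∀ k, 0 < k → k < w.length → w < w.rotate k

/-- Super Lyndon words over the alphabet of super-letters with basis `i`. -/
def IsSuperLyndonWord {G : SimpleGraph I} {i : I} (Ψ : Set I) (w : List (superLetters G i)) : Prop :=
  IsLyndonWord w ∨
    ∃ u : List (superLetters G i), (spelledHeap u).IsOdd Ψ ∧ IsLyndonWord u ∧ w = u ++ u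

end HeapsOfPieces

end

noncomputable section

open scoped Classical

namespace HeapsOfPieces

set_option linter.unusedSectionVars false

/-! Everything rests on heaps based at `i`: no floor position other than `i`, and no position below
`i`. This class is closed under products and under left factors. Such a nonempty heap is `i ∘ P ∘ Q`
with all positions of `P` above `i` and `Q` again based at `i`; since `i ∘ P` is a super-letter,
induction spells the heap by super-letters.

The standard word of `i ∘ P ∘ Q` is `i st(P) st(Q)`, so standard words concatenate along a spelling,
and each super-letter contributes one `i` followed by larger letters. As `i` marks where letters
begin, comparing standard words amounts to comparing spellings letter by letter
(`spelledHeap_strictMono`). Injectivity, hence freeness, follows.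

Rotating a spelling conjugates the heap, so a Lyndon heap gives a Lyndon word. Conversely, let `E`
be spelled by a Lyndon word, and let `F` be conjugate to `E`. Either `F` has a floor position above
`i`, so `st(F)` already exceeds `st(E)` at its first letter, or `F` is based at `i` and its spelling
is a rotation of that of `E`. -/

namespace Heap

variable {I : Type*} [LinearOrder I] {G : SimpleGraph I}

/-! ### Positions, floor pieces and left cancellation -/

/-- The multiset of positions of the pieces of a heap. -/
def content (E : Heap G) : Multiset I := E.pieces.val.map Prod.fst

lemma mem_content {E : Heap G} {a : I} : a ∈ E.content ↔ ∃ p ∈ E.pieces, p.1 = a := by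
  simp [content]

lemma content_ofWord (w : List I) : (ofWord G w).content = (w : Multiset I) := by
  rw [content, ← one_mul (ofWord G w), ← drop_eq_mul, drop_positions, one_pieces]
  simp

lemma ofWord_append (u v : List I) : ofWord G (u ++ v) = ofWord G u * ofWord G v := by
  simp [ofWord]

lemma ofWord_cons (a : I) (v : List I) : ofWord G (a :: v) = single G a * ofWord G v := by
  simp [ofWord]

lemma content_mul (E F : Heap G) : (E * F).content = E.content + F.content := by
  obtain ⟨u, rfl⟩ := ofWord_surjective E
  obtain ⟨v, rfl⟩ := ofWord_surjective F
  rw [← ofWord_append, content_ofWord, content_ofWord, content_ofWord, Multiset.coe_add]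

lemma content_single (a : I) : (single G a).content = {a} := rfl

lemma content_one : (1 : Heap G).content = 0 := rfl

lemma card_content (E : Heap G) : E.content.card = E.pieces.card := by
  simp [content]

lemma card_mul (E F : Heap G) : (E * F).pieces.card = E.pieces.card + F.pieces.card := by
  rw [← card_content, content_mul, Multiset.card_add, card_content, card_content]

lemma card_single (a : I) : (single G a).pieces.card = 1 := rfl

lemma eq_one_iff_pieces {E : Heap G} : E = 1 ↔ E.pieces = ∅ :=
  ⟨fun h => by rw [h, one_pieces], fun h => by ext1; rw [h, one_pieces]⟩

lemma push_induction {P : Heap G → Prop} (one : P 1)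
    (push : ∀ E a, P E → P (E.push a)) (E : Heap G) : P E := by
  obtain ⟨w, rfl⟩ := exists_drop E
  induction w using List.reverseRecOn with
  | nil => exact one
  | append_singleton w a ih =>
    have : (1 : Heap G).drop (w ++ [a]) = ((1 : Heap G).drop w).push a := by simp [drop]
    rw [this]
    exact push _ _ ih

lemma pieces_subset_mul (E F : Heap G) : E.pieces ⊆ (E * F).pieces := by
  induction F using push_induction with
  | one => simp
  | push F a ih =>
    rw [mul_push]
    exact ih.trans (Finset.subset_insert _ _)

lemma restLevel_eq_zero {E : Heap G} {a : I} :
    E.restLevel a = 0 ↔ ∀ b ∈ E.content, ¬ Conc G b a := by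
  constructor
  · intro h b hb hc
    obtain ⟨p, hp, rfl⟩ := mem_content.1 hb
    have := lt_restLevel hp hc
    omega
  · intro h
    exact restLevel_eq (fun q hq hc => absurd hc (h _ (mem_content.2 ⟨q, hq, rfl⟩))) (by simp)

/-- A single piece commutes with a heap none of whose positions is concurrent to it. -/
lemma single_mul_comm {E : Heap G} {a : I} (h : ∀ b ∈ E.content, ¬ Conc G b a) :
    single G a * E = E * single G a := by
  obtain ⟨w, rfl⟩ := ofWord_surjective E
  rw [content_ofWord] at h
  have := drop_push (1 : Heap G) a w (by simpa using h)
  rwa [drop_eq_mul, push_eq_mul, one_mul, push_eq_mul, drop_eq_mul, one_mul] at this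

/-- Two different pieces on top of the same heap commute and can both be removed. -/
lemma exists_of_push_eq_push {X Y : Heap G} {b c : I} (h : Y.push b = X.push c) (hbc : b ≠ c) :
    ¬ Conc G b c ∧ ∃ W : Heap G, Y = W.push c ∧ X = W.push b := by
  have hp : insert (b, Y.restLevel b) Y.pieces = insert (c, X.restLevel c) X.pieces :=
    congrArg pieces h
  have hmem : ∀ p, (p = (b, Y.restLevel b) ∨ p ∈ Y.pieces) ↔
      (p = (c, X.restLevel c) ∨ p ∈ X.pieces) := by
    intro p
    rw [← Finset.mem_insert, hp, Finset.mem_insert]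
  have hne : (b, Y.restLevel b) ≠ (c, X.restLevel c) := fun h => hbc (Prod.ext_iff.1 h).1
  have hc : (c, X.restLevel c) ∈ Y.pieces :=
    ((hmem _).2 (Or.inl rfl)).resolve_left hne.symm
  have hb : (b, Y.restLevel b) ∈ X.pieces := ((hmem _).1 (Or.inl rfl)).resolve_left hne
  -- Each of the two top pieces also lies in the heap under the other; if they were concurrent, each
  -- would be strictly below the other.
  have hcomm : ¬ Conc G b c := by
    intro hcc
    have h1 := lt_restLevel hc hcc.symm
    have h2 := lt_restLevel hb hcc
    simp only at h1 h2
    omega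
  have hYX : ∀ p ∈ Y.pieces, p ≠ (c, X.restLevel c) → p ∈ X.pieces := fun p hp hne =>
    ((hmem p).1 (Or.inr hp)).resolve_left hne
  have hXY : ∀ p ∈ X.pieces, p ≠ (b, Y.restLevel b) → p ∈ Y.pieces := fun p hp hne =>
    ((hmem p).2 (Or.inr hp)).resolve_left hne
  let W : Heap G :=
    { pieces := Y.pieces.erase (c, X.restLevel c)
      level_ne := fun q hq r hr =>
        Y.level_ne q (Finset.mem_of_mem_erase hq) r (Finset.mem_of_mem_erase hr)
      supported := by
        intro q hq h0
        obtain ⟨hq1, hq2⟩ := Finset.mem_erase.1 hq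
        obtain ⟨r, hr, h1, h2⟩ := Y.supported q hq2 h0
        refine ⟨r, Finset.mem_erase.2 ⟨?_, hr⟩, h1, h2⟩
        -- A piece resting on the removed one would lie in `X`, concurrent to `c`, hence below the
        -- level where `c` comes to rest over `X`.
        rintro rfl
        have := lt_restLevel (hYX q hq2 hq1) h2
        simp only at h1 this
        omega }
  have hW : ∀ p, p ∈ W.pieces ↔ p ≠ (c, X.restLevel c) ∧ p ∈ Y.pieces := fun p =>
    Finset.mem_erase
  have hWc : W.restLevel c = X.restLevel c := by
    apply restLevel_eq
    · intro q hq hcc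
      exact lt_restLevel (hYX q ((hW q).1 hq).2 ((hW q).1 hq).1) hcc
    · intro h0
      obtain ⟨q, hq, h1, h2⟩ := exists_restLevel h0
      refine ⟨q, (hW q).2 ⟨?_, hXY q hq ?_⟩, h1, h2⟩
      · rintro rfl
        simp only at h1
        omega
      · rintro rfl
        exact hcomm h2
  have hWb : W.restLevel b = Y.restLevel b := by
    apply restLevel_eq
    · intro q hq hcc
      exact lt_restLevel ((hW q).1 hq).2 hcc
    · intro h0
      obtain ⟨q, hq, h1, h2⟩ := exists_restLevel h0
      refine ⟨q, (hW q).2 ⟨?_, hq⟩, h1, h2⟩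
      rintro rfl
      exact hcomm h2.symm
  refine ⟨hcomm, W, ?_, ?_⟩
  · ext1
    change Y.pieces = insert (c, W.restLevel c) (Y.pieces.erase (c, X.restLevel c))
    rw [hWc, Finset.insert_erase hc]
  · ext p
    change p ∈ X.pieces ↔ p ∈ insert (b, W.restLevel b) W.pieces
    rw [hWb, Finset.mem_insert, hW]
    constructor
    · intro hp
      by_cases hpb : p = (b, Y.restLevel b)
      · exact Or.inl hpb
      · refine Or.inr ⟨?_, hXY p hp hpb⟩
        rintro rfl
        exact not_mem_push X c hp
    · rintro (rfl | ⟨h1, h2⟩)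
      · exact hb
      · exact hYX p h2 h1

/-- If the dropped pieces had different levels, each would belong to the other heap and so lie
strictly below the other piece. -/
lemma push_left_injective {X Y : Heap G} {a : I} (h : X.push a = Y.push a) : X = Y := by
  have hp : insert (a, X.restLevel a) X.pieces = insert (a, Y.restLevel a) Y.pieces :=
    congrArg pieces h
  have key : X.restLevel a = Y.restLevel a := by
    by_contra hne
    have hX : (a, X.restLevel a) ∈ Y.pieces := by
      have : (a, X.restLevel a) ∈ insert (a, Y.restLevel a) Y.pieces := by
        rw [← hp]; exact Finset.mem_insert_self _ _
      simpa [hne] using this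
    have hY : (a, Y.restLevel a) ∈ X.pieces := by
      have : (a, Y.restLevel a) ∈ insert (a, X.restLevel a) X.pieces := by
        rw [hp]; exact Finset.mem_insert_self _ _
      simpa [Ne.symm hne] using this
    have h1 := lt_restLevel hX (Or.inl rfl : Conc G a a)
    have h2 := lt_restLevel hY (Or.inl rfl : Conc G a a)
    simp only at h1 h2
    omega
  ext1
  rw [← Finset.erase_insert (not_mem_push X a), hp, key, Finset.erase_insert (not_mem_push Y a)]

lemma mem_floor_push {E : Heap G} {a b : I} :
    (a, 0) ∈ (E.push b).pieces ↔
      (a, 0) ∈ E.pieces ∨ (a = b ∧ ∀ c ∈ E.content, ¬ Conc G c a) := by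
  change (a, 0) ∈ insert (b, E.restLevel b) E.pieces ↔ _
  rw [Finset.mem_insert, Prod.mk.injEq, or_comm]
  refine or_congr Iff.rfl (and_congr_right ?_)
  rintro rfl
  rw [← restLevel_eq_zero, eq_comm]

/-- A position is on the floor of a superposition if it is on the floor of the lower heap, or
of the upper heap and free to fall past the lower one. -/
lemma mem_floor_mul {E F : Heap G} {a : I} :
    (a, 0) ∈ (E * F).pieces ↔
      (a, 0) ∈ E.pieces ∨ ((a, 0) ∈ F.pieces ∧ ∀ c ∈ E.content, ¬ Conc G c a) := by
  induction F using push_induction with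
  | one => simp [one_pieces]
  | push F b ih =>
    rw [mul_push, mem_floor_push, ih, mem_floor_push, content_mul]
    simp only [Multiset.mem_add]
    constructor
    · rintro ((h | h) | ⟨h, h'⟩)
      · exact Or.inl h
      · exact Or.inr ⟨Or.inl h.1, h.2⟩
      · exact Or.inr ⟨Or.inr ⟨h, fun c hc => h' c (Or.inr hc)⟩, fun c hc => h' c (Or.inl hc)⟩
    · rintro (h | ⟨h | h, h'⟩)
      · exact Or.inl (Or.inl h)
      · exact Or.inl (Or.inr ⟨h, h'⟩)
      · exact Or.inr ⟨h.1, fun c hc => hc.elim (h' c) (h.2 c)⟩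

lemma mem_floor_single_mul (a : I) (E : Heap G) : (a, 0) ∈ (single G a * E).pieces :=
  pieces_subset_mul _ _ (Finset.mem_singleton_self _)

/-- A piece on the floor can be taken off from below. -/
lemma exists_eq_single_mul {E : Heap G} {a : I} (h : (a, 0) ∈ E.pieces) :
    ∃ F : Heap G, E = single G a * F := by
  induction E using push_induction with
  | one => simp [one_pieces] at h
  | push E b ih =>
    rcases mem_floor_push.1 h with h' | ⟨rfl, h'⟩
    · obtain ⟨F, rfl⟩ := ih h'
      exact ⟨F.push b, (mul_push _ _ _).symm⟩
    · exact ⟨E, by rw [push_eq_mul, single_mul_comm h']⟩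

/-- Induction from the top. Equal last pieces are removed; different ones commute and sit on a
common heap `W`, from which the bottom piece can still be taken. -/
lemma single_mul_left_cancel {a : I} {X Y : Heap G}
    (h : single G a * X = single G a * Y) : X = Y := by
  induction hn : X.pieces.card generalizing X Y with
  | zero =>
    have hc := congrArg (fun E : Heap G => E.pieces.card) h
    simp only [card_mul] at hc
    rw [eq_one_iff_pieces.2 (Finset.card_eq_zero.1 hn),
      eq_one_iff_pieces.2 (Finset.card_eq_zero.1 (by omega : Y.pieces.card = 0))]
  | succ n ih =>
    have hc := congrArg (fun E : Heap G => E.pieces.card) h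
    simp only [card_mul] at hc
    obtain ⟨X', b, rfl⟩ := exists_push (Finset.card_pos.1 (by omega : 0 < X.pieces.card))
    obtain ⟨Y', c, rfl⟩ := exists_push (Finset.card_pos.1 (by omega : 0 < Y.pieces.card))
    rw [push_card] at hn
    rw [mul_push, mul_push] at h
    by_cases hbc : b = c
    · subst hbc
      rw [ih (push_left_injective h) (by omega)]
    · obtain ⟨hcomm, W, hX, hY⟩ := exists_of_push_eq_push h hbc
      -- Otherwise the floor piece at `a` would have come from both pushes, forcing `a = c` and `a =
      -- b`.
      have hW : (a, 0) ∈ W.pieces := by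
        have h1 := mem_floor_single_mul a X'
        have h2 := mem_floor_single_mul a Y'
        rw [hX, mem_floor_push] at h1
        rw [hY, mem_floor_push] at h2
        rcases h1 with h1 | ⟨h1, -⟩
        · exact h1
        · rcases h2 with h2 | ⟨h2, -⟩
          · exact h2
          · exact absurd (h2.symm.trans h1) hbc
      obtain ⟨W', rfl⟩ := exists_eq_single_mul hW
      rw [← mul_push] at hX hY
      have hX' := ih hX (by omega)
      rw [hX', push_card] at hn
      have hY' := ih hY.symm (by rw [push_card]; omega)
      rw [hX', ← hY', push_comm _ hcomm]

lemma exists_mem_floor {E : Heap G} (h : E ≠ 1) : ∃ a, (a, 0) ∈ E.pieces := by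
  obtain ⟨w, rfl⟩ := ofWord_surjective E
  cases w with
  | nil => exact absurd rfl h
  | cons a w => exact ⟨a, by rw [ofWord_cons]; exact mem_floor_single_mul _ _⟩

lemma mem_content_of_mem {E : Heap G} {a : I} {n : ℕ} (h : (a, n) ∈ E.pieces) : a ∈ E.content :=
  mem_content.2 ⟨_, h, rfl⟩

/-! ### Standard words -/

lemma ofWord_standardWord (E : Heap G) : ofWord G E.standardWord = E := (standardWord_spec E).1

lemma coe_standardWord (E : Heap G) : (E.standardWord : Multiset I) = E.content := by
  rw [← content_ofWord (G := G), ofWord_standardWord]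

lemma mem_standardWord {E : Heap G} {a : I} : a ∈ E.standardWord ↔ a ∈ E.content := by
  rw [← coe_standardWord, Multiset.mem_coe]

lemma standardWord_one : (1 : Heap G).standardWord = [] := by
  rw [← Multiset.coe_eq_zero, coe_standardWord, content_one]

lemma cons_le_cons_iff_lex {a b : I} {s t : List I} :
    a :: s ≤ b :: t ↔ a < b ∨ a = b ∧ s ≤ t := by
  rw [← not_lt, List.cons_lt_cons_iff]
  rcases lt_trichotomy a b with h | rfl | h
  · simp [h, h.ne', h.not_gt]
  · simp
  · simp [h, h.ne', h.not_gt]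

/-- The standard word starts with the greatest position on the floor. -/
lemma standardWord_single_mul {a : I} {E : Heap G}
    (h : ∀ b, (b, 0) ∈ (single G a * E).pieces → b ≤ a) :
    (single G a * E).standardWord = a :: E.standardWord := by
  refine (standardWord_spec (single G a * E)).unique ⟨?_, ?_⟩
  · change ofWord G (a :: E.standardWord) = _
    rw [ofWord_cons, ofWord_standardWord]
  · intro v hv
    change ofWord G v = _ at hv
    cases v with
    | nil => exact not_lt.1 (List.not_lt_nil _)
    | cons b v =>
      rw [ofWord_cons] at hv
      have hb : b ≤ a := h b (by rw [← hv]; exact mem_floor_single_mul _ _)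
      rcases hb.lt_or_eq with hb | rfl
      · exact cons_le_cons_iff_lex.2 (Or.inl hb)
      · rw [cons_le_cons_iff_lex]
        exact Or.inr ⟨rfl, (standardWord_spec E).2 (single_mul_left_cancel hv)⟩

lemma lt_iff_standardWord {E F : Heap G} : E < F ↔ E.standardWord < F.standardWord := Iff.rfl

/-! ### Minimal pieces, pyramids and based heaps -/

/-- A piece above the floor has a concurrent supporting piece, which precedes it; conversely the
level strictly increases along each step of the order, so nothing precedes a floor piece. -/
lemma mem_minPieces {E : Heap G} {p : I × ℕ} : p ∈ E.minPieces ↔ p ∈ E.pieces ∧ p.2 = 0 := by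
  constructor
  · rintro ⟨hp, hmin⟩
    refine ⟨hp, ?_⟩
    by_contra h0
    obtain ⟨q, hq, h1, h2⟩ := E.supported p hp (Nat.pos_of_ne_zero h0)
    have := hmin q hq (Relation.ReflTransGen.single ⟨hq, hp, h2.symm, by omega⟩)
    subst this
    omega
  · rintro ⟨hp, h0⟩
    refine ⟨hp, fun q _ hqp => ?_⟩
    rcases Relation.ReflTransGen.cases_tail hqp with h | ⟨r, -, -, -, -, hlt⟩
    · exact h.symm
    · omega

lemma isPyramid_iff {E : Heap G} {i : I} :
    E.IsPyramid i ↔ ∀ a, (a, 0) ∈ E.pieces ↔ a = i := by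
  constructor
  · rintro ⟨n, hn⟩ a
    have hi : (i, n) ∈ E.minPieces := by rw [hn]; rfl
    obtain rfl : n = 0 := (mem_minPieces.1 hi).2
    have : (a, 0) ∈ E.minPieces ↔ (a, 0) = (i, 0) := by rw [hn]; rfl
    rw [mem_minPieces] at this
    simpa using this
  · intro h
    refine ⟨0, Set.ext fun p => ?_⟩
    rw [mem_minPieces, Set.mem_singleton_iff]
    constructor
    · rintro ⟨hp, h0⟩
      exact Prod.ext ((h p.1).1 (by rwa [← h0])) h0
    · rintro rfl
      exact ⟨(h i).2 rfl, rfl⟩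

lemma count_content (E : Heap G) (a : I) :
    E.content.count a = (E.pieces.filter fun p => p.1 = a).card := by
  rw [content, Multiset.count_map, Finset.card_def, Finset.filter_val]
  simp only [eq_comm]

/-- The heaps that are empty or an admissible pyramid with basis `i`: no piece on the floor is
outside `i`, and `i` is the lowest position. -/
def IsBasedAt (E : Heap G) (i : I) : Prop :=
  (∀ a, (a, 0) ∈ E.pieces → a = i) ∧ ∀ a ∈ E.content, i ≤ a

lemma isBasedAt_one (i : I) : (1 : Heap G).IsBasedAt i :=
  ⟨by simp [one_pieces], by simp [content_one]⟩

lemma IsBasedAt.mul {E F : Heap G} {i : I} (hE : E.IsBasedAt i) (hF : F.IsBasedAt i) :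
    (E * F).IsBasedAt i := by
  refine ⟨fun a ha => ?_, fun a ha => ?_⟩
  · rcases mem_floor_mul.1 ha with h | h
    · exact hE.1 a h
    · exact hF.1 a h.1
  · rw [content_mul, Multiset.mem_add] at ha
    exact ha.elim (hE.2 a) (hF.2 a)

/-- The lower factor keeps its levels in a superposition. The upper factor need not be based: its
own floor may hold pieces held up by the lower one. -/
lemma IsBasedAt.of_mul {E F : Heap G} {i : I} (h : (E * F).IsBasedAt i) : E.IsBasedAt i :=
  ⟨fun a ha => h.1 a (pieces_subset_mul _ _ ha),
    fun a ha => h.2 a (by rw [content_mul]; exact Multiset.mem_add.2 (Or.inl ha))⟩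

lemma IsBasedAt.exists_eq_single_mul {E : Heap G} {i : I} (h : E.IsBasedAt i) (h1 : E ≠ 1) :
    ∃ F, E = single G i * F := by
  obtain ⟨a, ha⟩ := exists_mem_floor h1
  obtain rfl := h.1 a ha
  exact Heap.exists_eq_single_mul ha

/-- Floor pieces outside `i` are taken off from below into `P` until only `i` can remain on the
floor. -/
lemma exists_mul_isBasedAt {E : Heap G} {i : I} (h : ∀ a ∈ E.content, i ≤ a) :
    ∃ P Q : Heap G, E = P * Q ∧ (∀ a ∈ P.content, i < a) ∧ Q.IsBasedAt i := by
  induction hn : E.pieces.card generalizing E with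
  | zero =>
    refine ⟨1, 1, ?_, by simp [content_one], isBasedAt_one i⟩
    rw [eq_one_iff_pieces.2 (Finset.card_eq_zero.1 hn), one_mul]
  | succ n ih =>
    by_cases hf : ∀ a, (a, 0) ∈ E.pieces → a = i
    · exact ⟨1, E, (one_mul E).symm, by simp [content_one], hf, h⟩
    · push Not at hf
      obtain ⟨a, ha, hai⟩ := hf
      have hlt : i < a := lt_of_le_of_ne (h a (mem_content_of_mem ha)) hai.symm
      obtain ⟨F, rfl⟩ := Heap.exists_eq_single_mul ha
      rw [card_mul, card_single] at hn
      obtain ⟨P, Q, rfl, hP, hQ⟩ := ih (E := F)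
        (fun b hb => h b (by rw [content_mul]; exact Multiset.mem_add.2 (Or.inr hb))) (by omega)
      refine ⟨single G a * P, Q, (mul_assoc _ _ _).symm, fun b hb => ?_, hQ⟩
      rw [content_mul, Multiset.mem_add, content_single, Multiset.mem_singleton] at hb
      rcases hb with rfl | hb
      · exact hlt
      · exact hP b hb

/-- `Q` can add only `i` to the floor, so as long as `P` is nonempty its greatest floor position is
also that of `P * Q` and comes first in both standard words. -/
lemma standardWord_mul_of_lt {P Q : Heap G} {i : I} (hP : ∀ a ∈ P.content, i < a)
    (hQ : Q.IsBasedAt i) : (P * Q).standardWord = P.standardWord ++ Q.standardWord := by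
  induction hn : P.pieces.card generalizing P with
  | zero =>
    rw [eq_one_iff_pieces.2 (Finset.card_eq_zero.1 hn), one_mul, standardWord_one, List.nil_append]
  | succ n ih =>
    have hne : (P.standardWord) ≠ [] := by
      intro h0
      have := coe_standardWord P
      rw [h0] at this
      have := congrArg Multiset.card this
      rw [card_content] at this
      simp at this
      omega
    obtain ⟨a, t, hat⟩ := List.exists_cons_of_ne_nil hne
    have hPat : P = single G a * ofWord G t := by
      rw [← ofWord_cons, ← hat, ofWord_standardWord]
    have hmax : ∀ b, (b, 0) ∈ P.pieces → b ≤ a := by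
      intro b hb
      obtain ⟨R, hR⟩ := Heap.exists_eq_single_mul hb
      obtain ⟨v, rfl⟩ := ofWord_surjective R
      have hle : b :: v ≤ P.standardWord :=
        (standardWord_spec P).2 (by change ofWord G (b :: v) = P; rw [ofWord_cons, hR])
      rw [hat, cons_le_cons_iff_lex] at hle
      rcases hle with h | h
      · exact h.le
      · exact h.1.le
    obtain ⟨P', hP'⟩ : ∃ P', P' = ofWord G t := ⟨_, rfl⟩
    rw [← hP'] at hPat
    subst hPat
    rw [card_mul, card_single] at hn
    have hia : i < a := hP a (by simp [content_mul, content_single])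
    rw [mul_assoc, standardWord_single_mul, standardWord_single_mul hmax, ih _ (by omega),
      List.cons_append]
    · intro b hb
      exact hP b (by rw [content_mul]; exact Multiset.mem_add.2 (Or.inr hb))
    · intro b hb
      rw [← mul_assoc] at hb
      rcases mem_floor_mul.1 hb with h | h
      · exact hmax b h
      · rw [hQ.1 b h.1]
        exact hia.le

lemma IsBasedAt.single_mul {X : Heap G} {i : I} (h : (single G i * X).IsBasedAt i) :
    (single G i * X).standardWord = i :: X.standardWord :=
  standardWord_single_mul fun b hb => (h.1 b hb).le

end Heap

/-! ### Factorization into super-letters -/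

open Heap

variable {I : Type*} [LinearOrder I] {G : SimpleGraph I} {i : I}

/-- The count excludes the empty heap, which is based at `i` but is not a pyramid. -/
lemma mem_superLetters_iff {E : Heap G} :
    E ∈ superLetters G i ↔ E.IsBasedAt i ∧ E.content.count i = 1 := by
  constructor
  · rintro ⟨⟨hp, hle⟩, -, hc⟩
    refine ⟨⟨fun a ha => (isPyramid_iff.1 hp a).1 ha, fun a ha => ?_⟩, ?_⟩
    · obtain ⟨p, hp, rfl⟩ := mem_content.1 ha
      exact hle p hp
    · rw [count_content, hc]
  · rintro ⟨h, hc⟩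
    have h1 : E ≠ 1 := by
      rintro rfl
      simp [content_one] at hc
    obtain ⟨F, rfl⟩ := h.exists_eq_single_mul h1
    have hp : (single G i * F).IsPyramid i :=
      isPyramid_iff.2 fun a => ⟨h.1 a, fun ha => ha ▸ mem_floor_single_mul i F⟩
    exact ⟨⟨hp, fun p hp => h.2 _ (mem_content_of_mem hp)⟩, hp, by rw [← count_content, hc]⟩

lemma exists_eq_single_mul_of_mem_superLetters {E : Heap G} (h : E ∈ superLetters G i) :
    ∃ X : Heap G, E = single G i * X ∧ ∀ a ∈ X.content, i < a := by
  obtain ⟨hb, hc⟩ := mem_superLetters_iff.1 h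
  have h1 : E ≠ 1 := by
    rintro rfl
    simp [content_one] at hc
  obtain ⟨X, rfl⟩ := hb.exists_eq_single_mul h1
  refine ⟨X, rfl, fun a ha => lt_of_le_of_ne (hb.2 a ?_) ?_⟩
  · rw [content_mul]
    exact Multiset.mem_add.2 (Or.inr ha)
  · rintro rfl
    rw [content_mul, content_single, Multiset.count_add, Multiset.count_singleton_self] at hc
    have := Multiset.count_pos.2 ha
    omega

lemma spelledHeap_nil : spelledHeap ([] : List (superLetters G i)) = 1 := rfl

lemma spelledHeap_cons (x : superLetters G i) (w : List (superLetters G i)) :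
    spelledHeap (x :: w) = x.1 * spelledHeap w := by
  simp [spelledHeap]

lemma spelledHeap_append (u v : List (superLetters G i)) :
    spelledHeap (u ++ v) = spelledHeap u * spelledHeap v := by
  simp [spelledHeap]

lemma isBasedAt_spelledHeap (w : List (superLetters G i)) : (spelledHeap w).IsBasedAt i := by
  induction w with
  | nil => exact isBasedAt_one i
  | cons x w ih =>
    rw [spelledHeap_cons]
    exact (mem_superLetters_iff.1 x.2).1.mul ih

/-- Heaps based at `i` are spelled by super-letters. -/
lemma exists_spelledHeap_eq {E : Heap G} (h : E.IsBasedAt i) :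
    ∃ w : List (superLetters G i), spelledHeap w = E := by
  induction hn : E.pieces.card using Nat.strong_induction_on generalizing E with
  | _ n ih =>
    by_cases h1 : E = 1
    · exact ⟨[], by rw [h1, spelledHeap_nil]⟩
    · obtain ⟨F, rfl⟩ := h.exists_eq_single_mul h1
      obtain ⟨P, Q, rfl, hP, hQ⟩ := exists_mul_isBasedAt (E := F) (i := i) fun a ha =>
        h.2 a (by rw [content_mul]; exact Multiset.mem_add.2 (Or.inr ha))
      rw [card_mul, card_mul, card_single] at hn
      obtain ⟨w, hw⟩ := ih Q.pieces.card (by omega) hQ rfl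
      rw [← mul_assoc] at h ⊢
      -- The bottom `i` is the only one in this factor, because `P` lies strictly above `i`.
      have hmem : single G i * P ∈ superLetters G i := by
        refine mem_superLetters_iff.2 ⟨h.of_mul, ?_⟩
        rw [content_mul, content_single, Multiset.count_add, Multiset.count_singleton_self,
          Multiset.count_eq_zero_of_notMem fun hi => lt_irrefl _ (hP i hi)]
      exact ⟨⟨_, hmem⟩ :: w, by rw [spelledHeap_cons, hw]⟩

lemma isBasedAt_of_mem_superLetterMonoid {E : Heap G} (h : E ∈ superLetterMonoid G i) :
    E.IsBasedAt i := by
  induction h using Submonoid.closure_induction with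
  | mem x hx => exact (mem_superLetters_iff.1 hx).1
  | one => exact isBasedAt_one i
  | mul x y _ _ hx hy => exact hx.mul hy

/-! ### Order comparison and freeness -/

lemma standardWord_spelledHeap_cons (x : superLetters G i) (w : List (superLetters G i)) :
    (spelledHeap (x :: w)).standardWord = x.1.standardWord ++ (spelledHeap w).standardWord := by
  have hb := isBasedAt_spelledHeap (x :: w)
  rw [spelledHeap_cons] at hb ⊢
  obtain ⟨X, hX, hlt⟩ := exists_eq_single_mul_of_mem_superLetters x.2
  rw [hX] at hb ⊢
  rw [hb.of_mul.single_mul, mul_assoc, List.cons_append,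
    ← standardWord_mul_of_lt hlt (isBasedAt_spelledHeap w)]
  rw [mul_assoc] at hb
  exact hb.single_mul

lemma standardWord_spelledHeap_head (w : List (superLetters G i)) :
    (spelledHeap w).standardWord = [] ∨ ∃ t, (spelledHeap w).standardWord = i :: t := by
  cases w with
  | nil => exact Or.inl standardWord_one
  | cons x w =>
    obtain ⟨X, hX, -⟩ := exists_eq_single_mul_of_mem_superLetters x.2
    have hb := (mem_superLetters_iff.1 x.2).1
    rw [hX] at hb
    exact Or.inr ⟨X.standardWord ++ (spelledHeap w).standardWord, by
      rw [standardWord_spelledHeap_cons, hX, hb.single_mul, List.cons_append]⟩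

/-- The delicate case is `s` a proper prefix of `t`: the next letter on the left is then `i` or
missing, while on the right it is a letter of `t`, larger than `i`. -/
lemma append_lt_append_of_lt {s t r r' : List I} (hst : s < t) (ht : ∀ a ∈ t, i < a)
    (hr : r = [] ∨ ∃ q, r = i :: q) : s ++ r < t ++ r' := by
  induction s generalizing t with
  | nil =>
    cases t with
    | nil => exact absurd hst (lt_irrefl _)
    | cons c t =>
      rcases hr with rfl | ⟨q, rfl⟩
      · exact List.Lex.nil
      · exact List.Lex.rel (ht c (by simp))
  | cons a s ih =>
    cases t with
    | nil => exact absurd hst (List.not_lt_nil _)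
    | cons c t =>
      rw [List.cons_append, List.cons_append, List.cons_lt_cons_iff]
      rcases List.cons_lt_cons_iff.1 hst with h | ⟨rfl, h⟩
      · exact Or.inl h
      · exact Or.inr ⟨rfl, ih h fun b hb => ht b (by simp [hb])⟩

lemma append_lt_append_left {s t : List I} (r : List I) (h : s < t) : r ++ s < r ++ t := by
  induction r with
  | nil => exact h
  | cons a r ih => exact List.cons_lt_cons_iff.2 (Or.inr ⟨rfl, ih⟩)

/-- The lexicographic order of words in super-letters agrees with the order of heaps. -/
lemma spelledHeap_strictMono : StrictMono (spelledHeap (G := G) (i := i)) := by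
  intro u
  induction u with
  | nil =>
    intro v h
    cases v with
    | nil => exact absurd h (lt_irrefl _)
    | cons y v =>
      obtain ⟨X, hX, -⟩ := exists_eq_single_mul_of_mem_superLetters y.2
      have hb := (mem_superLetters_iff.1 y.2).1
      rw [hX] at hb
      rw [lt_iff_standardWord, standardWord_spelledHeap_cons, hX, hb.single_mul, spelledHeap_nil,
        standardWord_one]
      exact List.Lex.nil
  | cons x u ih =>
    intro v h
    cases v with
    | nil => exact absurd h (List.not_lt_nil _)
    | cons y v =>
      rw [lt_iff_standardWord, standardWord_spelledHeap_cons, standardWord_spelledHeap_cons]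
      rcases List.cons_lt_cons_iff.1 h with h' | ⟨rfl, h'⟩
      -- Both standard words start with `i`; past it, the letters of `y` exceed `i`, so the first
      -- difference is decided before the tails `u` and `v` matter.
      · have hxy : x.1.standardWord < y.1.standardWord := h'
        obtain ⟨X, hX, -⟩ := exists_eq_single_mul_of_mem_superLetters x.2
        obtain ⟨Y, hY, hYlt⟩ := exists_eq_single_mul_of_mem_superLetters y.2
        have hbx := (mem_superLetters_iff.1 x.2).1
        have hby := (mem_superLetters_iff.1 y.2).1
        rw [hX] at hbx
        rw [hY] at hby
        rw [hX, hY, hbx.single_mul, hby.single_mul] at hxy ⊢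
        rw [List.cons_append, List.cons_append, List.cons_lt_cons_iff]
        refine Or.inr ⟨rfl, append_lt_append_of_lt (i := i) ?_
          (fun a ha => hYlt a (mem_standardWord.1 ha)) (standardWord_spelledHeap_head u)⟩
        exact (List.cons_lt_cons_iff.1 hxy).elim (fun h => absurd h (lt_irrefl _)) And.right
      · exact append_lt_append_left _ (ih h')

lemma spelledHeap_injective : Function.Injective (spelledHeap (G := G) (i := i)) :=
  spelledHeap_strictMono.injective

lemma spelledHeap_eq_one_iff {w : List (superLetters G i)} : spelledHeap w = 1 ↔ w = [] :=
  ⟨fun h => spelledHeap_injective (h.trans spelledHeap_nil.symm),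
    fun h => by rw [h, spelledHeap_nil]⟩

/-! ### Conjugacy and Lyndon words -/

/-- Conjugate heaps are intertwined by a heap with no new positions. -/
lemma exists_mul_eq_mul_of_isConjugate {E F : Heap G} (h : IsConjugate E F) :
    F.content = E.content ∧ ∃ X : Heap G, E * X = X * F ∧ ∀ a ∈ X.content, a ∈ E.content := by
  have key : ∀ E F : Heap G, IsTranspose E F →
      F.content = E.content ∧ ∃ X : Heap G, E * X = X * F ∧ ∀ a ∈ X.content, a ∈ E.content := by
    rintro _ _ ⟨U, V, rfl, rfl⟩
    refine ⟨by rw [content_mul, content_mul, add_comm], U, mul_assoc _ _ _, fun a ha => ?_⟩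
    rw [content_mul]
    exact Multiset.mem_add.2 (Or.inl ha)
  induction h with
  | single h => exact key _ _ h
  | tail _ h ih =>
    obtain ⟨h1, X, hX, hXc⟩ := ih
    obtain ⟨h2, Y, hY, hYc⟩ := key _ _ h
    refine ⟨h2.trans h1, X * Y, ?_, fun a ha => ?_⟩
    · rw [← mul_assoc, hX, mul_assoc, hY, mul_assoc]
    · rw [content_mul, Multiset.mem_add] at ha
      exact ha.elim (hXc a) (fun h => h1 ▸ hYc a h)

/-- Copies of `e` are stripped from the front of `x` until what is left is a prefix of `e`; that
prefix is the rotation point. -/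
lemma exists_append_of_append_eq_append {A : Type*} {e x f : List A} (h : e ++ x = x ++ f) :
    ∃ u v, e = u ++ v ∧ f = v ++ u := by
  induction hn : x.length using Nat.strong_induction_on generalizing x with
  | _ n ih =>
    rcases List.append_eq_append_iff.1 h with ⟨y, rfl, hy⟩ | ⟨y, rfl, rfl⟩
    · by_cases he : e = []
      · subst he
        exact ⟨[], [], rfl, by simpa using (congrArg List.length h)⟩
      · have : 0 < e.length := List.length_pos_iff.2 he
        rw [List.length_append] at hn
        exact ih y.length (by omega) hy rfl
    · exact ⟨x, y, rfl, rfl⟩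

lemma IsLyndonWord.lt_append {A : Type*} [LinearOrder A] {u v : List A}
    (h : IsLyndonWord (u ++ v)) (hu : u ≠ []) (hv : v ≠ []) : u ++ v < v ++ u := by
  have hu' := List.length_pos_iff.2 hu
  have hv' := List.length_pos_iff.2 hv
  have := h.2 u.length hu' (by rw [List.length_append]; omega)
  rwa [List.rotate_append_length_eq] at this

/-- Rotations spell transposes, so minimality gives the weak inequality and primitivity excludes
equality. -/
lemma isLyndonWord_of_isLyndon {w : List (superLetters G i)} (h : (spelledHeap w).IsLyndon) :
    IsLyndonWord w := by
  obtain ⟨h1, hprim, hmin⟩ := h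
  refine ⟨fun hw => h1 (spelledHeap_eq_one_iff.2 hw), fun k hk hkw => ?_⟩
  rw [List.rotate_eq_drop_append_take hkw.le]
  have hw : w = w.take k ++ w.drop k := (List.take_append_drop k w).symm
  have hsw : spelledHeap w = spelledHeap (w.take k) * spelledHeap (w.drop k) := by
    rw [← spelledHeap_append, ← hw]
  rw [← spelledHeap_strictMono.lt_iff_lt, spelledHeap_append]
  refine lt_of_le_of_ne (hmin _ (Relation.TransGen.single ⟨_, _, hsw, rfl⟩)) fun heq => ?_
  rcases hprim _ _ hsw heq with h | h
  · have := congrArg List.length (spelledHeap_eq_one_iff.1 h)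
    rw [List.length_take, List.length_nil] at this
    omega
  · have := congrArg List.length (spelledHeap_eq_one_iff.1 h)
    rw [List.length_drop, List.length_nil] at this
    omega

/-- Commuting factors are both left factors, hence both spelled by words; these words commute, so a
proper rotation would fix the Lyndon word. -/
lemma IsLyndonWord.isPrimitive_spelledHeap {w : List (superLetters G i)} (h : IsLyndonWord w) :
    (spelledHeap w).IsPrimitive := by
  intro U V hUV hVU
  have hb := isBasedAt_spelledHeap w
  obtain ⟨u, rfl⟩ := exists_spelledHeap_eq (hUV ▸ hb).of_mul
  obtain ⟨v, rfl⟩ := exists_spelledHeap_eq (hVU ▸ hb).of_mul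
  rw [← spelledHeap_append] at hUV hVU
  obtain rfl := spelledHeap_injective hUV
  have hcomm := spelledHeap_injective hVU
  rw [spelledHeap_eq_one_iff, spelledHeap_eq_one_iff]
  by_contra! hne
  exact (h.lt_append hne.1 hne.2).ne hcomm

lemma IsLyndonWord.le_of_isConjugate {w : List (superLetters G i)} (h : IsLyndonWord w)
    {F : Heap G} (hF : IsConjugate (spelledHeap w) F) : spelledHeap w ≤ F := by
  have hb := isBasedAt_spelledHeap w
  obtain ⟨hc, X, hX, hXc⟩ := exists_mul_eq_mul_of_isConjugate hF
  by_cases hf : ∀ a, (a, 0) ∈ F.pieces → a = i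
  · obtain ⟨f, rfl⟩ := exists_spelledHeap_eq (i := i) (E := F) ⟨hf, hc ▸ hb.2⟩
    -- A floor piece of `X` is on the floor of `spelledHeap w * X`. It cannot have fallen past
    -- `spelledHeap w`, which already has a piece at that position, so it is at `i`.
    have hXb : X.IsBasedAt i := by
      refine ⟨fun a ha => ?_, fun a ha => hb.2 a (hXc a ha)⟩
      have : (a, 0) ∈ (spelledHeap w * X).pieces := hX ▸ pieces_subset_mul _ _ ha
      rcases mem_floor_mul.1 this with h | h
      · exact hb.1 a h
      · exact absurd (Or.inl rfl) (h.2 a (hXc a (mem_content_of_mem ha)))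
    obtain ⟨x, rfl⟩ := exists_spelledHeap_eq hXb
    rw [← spelledHeap_append, ← spelledHeap_append] at hX
    obtain ⟨u, v, rfl, rfl⟩ := exists_append_of_append_eq_append (spelledHeap_injective hX)
    by_cases hu : u = []
    · simp [hu]
    by_cases hv : v = []
    · simp [hv]
    exact (spelledHeap_strictMono (h.lt_append hu hv)).le
  · push Not at hf
    obtain ⟨a, ha, hai⟩ := hf
    -- Conjugation preserves positions, so a floor position other than `i` exceeds `i`, and a word
    -- for `F` can start with it.
    have hia : i < a :=
      lt_of_le_of_ne (hb.2 a (hc ▸ mem_content_of_mem ha)) hai.symm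
    obtain ⟨R, hR⟩ := Heap.exists_eq_single_mul ha
    obtain ⟨v, rfl⟩ := ofWord_surjective R
    have hle : a :: v ≤ F.standardWord :=
      (standardWord_spec F).2 (by change ofWord G (a :: v) = F; rw [ofWord_cons, hR])
    refine (lt_iff_standardWord.2 (lt_of_lt_of_le ?_ hle)).le
    rcases standardWord_spelledHeap_head w with h | ⟨t, h⟩
    · rw [h]
      exact List.Lex.nil
    · rw [h]
      exact List.Lex.rel hia

/-- A word in super-letters is a Lyndon word if and only if it spells a Lyndon heap. -/
lemma isLyndonWord_iff {w : List (superLetters G i)} :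
    IsLyndonWord w ↔ (spelledHeap w).IsLyndon :=
  ⟨fun h => ⟨fun h1 => h.1 (spelledHeap_eq_one_iff.1 h1), h.isPrimitive_spelledHeap,
    fun _ hF => h.le_of_isConjugate hF⟩, isLyndonWord_of_isLyndon⟩

/-- In the square case `F` is a left factor of a based heap, hence spelled by a word, and
injectivity lifts the square to words. -/
lemma isSuperLyndonWord_iff (Ψ : Set I) {w : List (superLetters G i)} :
    IsSuperLyndonWord Ψ w ↔ (spelledHeap w).IsSuperLyndon Ψ := by
  refine or_congr isLyndonWord_iff ⟨?_, ?_⟩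
  · rintro ⟨u, hodd, hu, rfl⟩
    exact ⟨spelledHeap u, hodd, isLyndonWord_iff.1 hu, spelledHeap_append u u⟩
  · rintro ⟨F, hodd, hF, hw⟩
    obtain ⟨u, rfl⟩ := exists_spelledHeap_eq (hw ▸ isBasedAt_spelledHeap w).of_mul
    refine ⟨u, hodd, isLyndonWord_iff.2 hF, spelledHeap_injective ?_⟩
    rw [hw, spelledHeap_append]

end HeapsOfPieces

end

theorem mainTheorem8 {I : Type*} [LinearOrder I] (G : SimpleGraph I) (Ψ : Set I) (i : I)
    (E : HeapsOfPieces.Heap G) (hE : E ∈ HeapsOfPieces.superLetterMonoid G i) :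
    (∃! w : List (HeapsOfPieces.superLetters G i), HeapsOfPieces.spelledHeap w = E) ∧
    ∀ w : List (HeapsOfPieces.superLetters G i), HeapsOfPieces.spelledHeap w = E →
      (HeapsOfPieces.IsSuperLyndonWord Ψ w ↔ E.IsSuperLyndon Ψ) := by
  refine ⟨?_, ?_⟩
  · obtain ⟨w, hw⟩ := HeapsOfPieces.exists_spelledHeap_eq
      (HeapsOfPieces.isBasedAt_of_mem_superLetterMonoid hE)
    exact ⟨w, hw, fun v hv => HeapsOfPieces.spelledHeap_injective (hv.trans hw.symm)⟩
  · rintro w rfl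
    exact HeapsOfPieces.isSuperLyndonWord_iff Ψ
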